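/- Let $q$ be an odd prime power, let $\mathbb{F}_q$ be the finite field with $q$ elements, and let $u, v \in \mathbb{F}_q$ with $u \neq v$. For an integer $m \ge 1$ let $C_{u,v}(m)$ be the set of monic irreducible polynomials $f \in \mathbb{F}_q[x]$ of degree $m$ such that $f(u)f(v)$ is a nonsquare in $\mathbb{F}_q$, and let $D_{u,v}(m)$ be the set of monic irreducible polynomials $f \in \mathbb{F}_q[x]$ of degree $m$ such that $f(u)f(v)$ is a nonzero square in $\mathbb{F}_q$. (For $m \ge 2$ these two sets partition the set of monic irreducible polynomials of degree $m$.) Then for every integer $n \ge 2$ $$|C_{u,v}(n)| - |D_{u,v}(n)| = \begin{cases} 0, & \text{if } 2 \nmid n,\\ |C_{u,v}(n/2)|, & \text{if } 2 \mid n. \end{cases}$$ -/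

import Mathlib

open Polynomial

/-- The set of monic irreducible polynomials of degree `n` over `F`. -/
def monicIrreducibles (F : Type*) [Field F] (n : ℕ) : Set F[X] :=
  {f | f.Monic ∧ Irreducible f ∧ f.natDegree = n}

/-- The monic irreducible `f` of degree `n` with Legendre symbol `(f(u) f(v) / q) = -1`,
i.e. with `f(u) f(v)` a nonsquare. -/
def nonsquareSet {F : Type*} [Field F] [Fintype F] [DecidableEq F] (u v : F) (n : ℕ) : Set F[X] :=
  {f | f ∈ monicIrreducibles F n ∧ quadraticChar F (f.eval u * f.eval v) = -1}

/-- The monic irreducible `f` of degree `n` with Legendre symbol `(f(u) f(v) / q) = 1`,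
i.e. with `f(u) f(v)` a nonzero square. -/
def squareSet {F : Type*} [Field F] [Fintype F] [DecidableEq F] (u v : F) (n : ℕ) : Set F[X] :=
  {f | f ∈ monicIrreducibles F n ∧ quadraticChar F (f.eval u * f.eval v) = 1}

/-- Over a finite field there are finitely many monic irreducibles of each degree, so that
`Set.ncard` of the sets above is their actual number of elements. -/
theorem monicIrreducibles_finite (F : Type*) [Field F] [Finite F] (n : ℕ) :
    (monicIrreducibles F n).Finite := by
  have hfin : Finite (Polynomial.degreeLT F (n + 1)) :=
    Finite.of_equiv _ (Polynomial.degreeLTEquiv F (n + 1)).toEquiv.symm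
  refine Set.Finite.subset (Set.toFinite (Polynomial.degreeLT F (n + 1) : Set F[X])) ?_
  rintro f ⟨hm, -, hd⟩
  rw [SetLike.mem_coe, Polynomial.mem_degreeLT, Polynomial.degree_eq_natDegree hm.ne_zero, hd]
  exact_mod_cast Nat.lt_succ_self n

/-- For `n ≥ 2` the two sets are complementary in the monic irreducibles of degree `n`. -/
theorem squareSet_eq_diff {F : Type*} [Field F] [Fintype F] [DecidableEq F] (u v : F) (n : ℕ)
    (hn : 2 ≤ n) :
    squareSet u v n = monicIrreducibles F n \ nonsquareSet u v n := by
  have hne : ∀ f ∈ monicIrreducibles F n, ∀ a : F, f.eval a ≠ 0 := by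
    rintro f ⟨_, hi, hd⟩ a h0
    have h1 := Polynomial.degree_eq_one_of_irreducible_of_root hi (x := a) h0
    have h2 : f.natDegree = 1 := Polynomial.natDegree_eq_of_degree_eq_some h1
    omega
  have hchar : (1 : ℤ) ≠ -1 := by norm_num
  ext f
  constructor
  · rintro ⟨hf, h1⟩
    refine ⟨hf, fun h => hchar (h1.symm.trans h.2)⟩
  · rintro ⟨hf, h1⟩
    refine ⟨hf, ?_⟩
    rcases quadraticChar_dichotomy (mul_ne_zero (hne f hf u) (hne f hf v)) with h | h
    · exact h
    · exact absurd ⟨hf, h⟩ h1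

/-! Let `K` be the extension of degree `n` and `ψ` the quadratic character of `F` composed with the
norm. The sum of `ψ ((x - u) * (x - v))` over `K` is a Jacobi sum equal to `-1`. Grouping `x` by its
minimal polynomial `f` turns each term into `χ(f(u)f(v)) ^ (n / deg f)`, which gives `∑_{d ∣ n} d
(D(d) + (-1)^(n/d) C(d)) = -1` (`sum_divisors_square_nonsquare`). Reindexing the even quotients `n /
d` turns this into `∑_{d ∣ n} g d = 1` for every `n ≥ 1`, where `g d = d (C(d) - D(d) - [2 ∣ d]
C(d/2))`. Hence `g` vanishes from 2 on. -/

/-- The multiplicative character of a finite extension `K / F` obtained by composing a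
multiplicative character of `F` with the norm. -/
noncomputable def MulChar.compNorm {F : Type*} (K : Type*) [Field F] [Field K] [Algebra F K]
    [FiniteDimensional F K] {R : Type*} [CommMonoidWithZero R] (χ : MulChar F R) : MulChar K R where
  toMonoidHom := χ.toMonoidHom.comp (Algebra.norm F)
  map_nonunit' a ha := by
    have h0 : a = 0 := by simpa using ha
    subst h0
    simp

theorem MulChar.compNorm_apply {F : Type*} (K : Type*) [Field F] [Field K] [Algebra F K]
    [FiniteDimensional F K] {R : Type*} [CommMonoidWithZero R] (χ : MulChar F R) (x : K) :
    χ.compNorm K x = χ (Algebra.norm F x) := rfl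

theorem MulChar.compNorm_ne_one {F : Type*} (K : Type*) [Field F] [Field K] [Algebra F K]
    [Finite K] [FiniteDimensional F K] {R : Type*} [CommMonoidWithZero R] {χ : MulChar F R}
    (hχ : χ ≠ 1) : χ.compNorm K ≠ 1 := by
  intro h
  apply hχ
  ext a
  obtain ⟨x, hx⟩ := FiniteField.norm_surjective F K (a : F)
  have hx0 : x ≠ 0 := by
    rintro rfl
    exact a.ne_zero (by rw [← hx, Algebra.norm_zero])
  have h1 := congrArg (fun ψ : MulChar K R => ψ x) h
  simp only [MulChar.compNorm_apply, hx, MulChar.one_apply hx0.isUnit] at h1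
  rw [h1, MulChar.one_apply_coe]

theorem MulChar.IsQuadratic.compNorm {F : Type*} (K : Type*) [Field F] [Field K] [Algebra F K]
    [FiniteDimensional F K] {R : Type*} [CommRing R] {χ : MulChar F R}
    (hχ : χ.IsQuadratic) : (χ.compNorm K).IsQuadratic :=
  fun x => hχ (Algebra.norm F x)

/-- The substitution `x = u + t (v - u)` yields `ψ (-1)` times the Jacobi sum of `ψ` with itself; as
`ψ` is its own inverse, that Jacobi sum is `-ψ (-1)`. -/
theorem MulChar.IsQuadratic.sum_mul_sub {K : Type*} [Field K] [Fintype K] {ψ : MulChar K ℤ}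
    (hq : ψ.IsQuadratic) (hψ : ψ ≠ 1) {u v : K} (huv : u ≠ v) :
    ∑ x : K, ψ ((x - u) * (x - v)) = -1 := by
  classical
  have hw : v - u ≠ 0 := sub_ne_zero.mpr huv.symm
  have hsq : ∀ {y : K}, y ≠ 0 → ψ (y * y) = 1 := fun {y} hy => by
    have hu : IsUnit (ψ y) := hy.isUnit.map ψ
    rcases hq y with h | h | h
    · simp [h] at hu
    · simp [h]
    · simp [h]
  have hj := jacobiSum_nontrivial_inv hψ
  rw [hq.inv, jacobiSum] at hj
  have hsum : ∑ x : K, ψ ((x - u) * (x - v)) = ∑ t : K, ψ (-1) * (ψ t * ψ (1 - t)) := by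
    refine (Fintype.sum_equiv ((Equiv.mulRight₀ (v - u) hw).trans (Equiv.addRight u)) _ _ ?_).symm
    intro t
    have : ((Equiv.mulRight₀ (v - u) hw).trans (Equiv.addRight u)) t = t * (v - u) + u := rfl
    -- With `w = v - u`, the argument is `-t (1 - t) w²`, so a factor `ψ (w * w) = 1` is inserted to
    -- match.
    rw [this, ← map_mul, ← map_mul, ← mul_one (ψ (-1 * _)), ← hsq hw, ← map_mul]
    congr 1
    ring
  rw [hsum, ← Finset.mul_sum, hj, mul_neg, ← map_mul, hsq (neg_ne_zero.mpr one_ne_zero)]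

-- The minimal polynomial of `a - u` is that of `a` shifted by `u`, with constant term its value at
-- `u`. The norm from `F(a - u)` is this value up to sign, and the rest of the tower contributes a
-- power.
open IntermediateField in
theorem Algebra.norm_sub_algebraMap {F K : Type*} [Field F] [Field K] [Algebra F K]
    [FiniteDimensional F K] [Algebra.IsSeparable F K] (a : K) (u : F) :
    Algebra.norm F (a - algebraMap F K u) =
      (-1) ^ Module.finrank F K *
        ((minpoly F a).eval u) ^ (Module.finrank F K / (minpoly F a).natDegree) := by
  have hai : IsIntegral F a := Algebra.IsIntegral.isIntegral a
  have hbi : IsIntegral F (a - algebraMap F K u) := Algebra.IsIntegral.isIntegral _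
  have hmin := minpoly.sub_algebraMap (A := F) a u
  have hdeg : (minpoly F (a - algebraMap F K u)).natDegree = (minpoly F a).natDegree := by
    rw [hmin, natDegree_comp, natDegree_X_add_C, mul_one]
  have hfr := IntermediateField.adjoin.finrank hbi
  have hmul := Module.finrank_mul_finrank F F⟮a - algebraMap F K u⟯ K
  have hpos := minpoly.natDegree_pos hai
  rw [hfr, hdeg] at hmul
  have hquot : Module.finrank F⟮a - algebraMap F K u⟯ K =
      Module.finrank F K / (minpoly F a).natDegree := by
    rw [← hmul, Nat.mul_div_cancel_left _ hpos]
  have hgen : Algebra.norm F (AdjoinSimple.gen F (a - algebraMap F K u)) =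
      (-1) ^ (minpoly F (a - algebraMap F K u)).natDegree *
        (minpoly F (AdjoinSimple.gen F (a - algebraMap F K u))).coeff 0 :=
    Algebra.PowerBasis.norm_gen_eq_coeff_zero_minpoly
      (IntermediateField.adjoin.powerBasis hbi)
  rw [minpoly_gen, hdeg, hmin, coeff_zero_eq_eval_zero, eval_comp] at hgen
  simp only [eval_add, eval_X, eval_C, zero_add] at hgen
  rw [Algebra.norm_eq_norm_adjoin, hgen, mul_pow, ← pow_mul, hquot]
  congr 2
  rw [← hquot, hmul]

theorem Algebra.norm_sub_mul_sub {F K : Type*} [Field F] [Field K] [Algebra F K]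
    [FiniteDimensional F K] [Algebra.IsSeparable F K] (a : K) (u v : F) :
    Algebra.norm F ((a - algebraMap F K u) * (a - algebraMap F K v)) =
      ((minpoly F a).eval u * (minpoly F a).eval v) ^
        (Module.finrank F K / (minpoly F a).natDegree) := by
  rw [map_mul, norm_sub_algebraMap, norm_sub_algebraMap, mul_mul_mul_comm, ← mul_pow, ← mul_pow]
  simp

/-- The degree condition embeds `AdjoinRoot p` in `K`, so `p` has a root there; normality then
splits `p`, and separability makes its roots distinct. -/
theorem card_filter_minpoly_eq {F K : Type*} [Field F] [Field K] [Algebra F K] [Fintype K]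
    [FiniteDimensional F K] [DecidableEq F[X]] {p : F[X]} (hm : p.Monic) (hi : Irreducible p)
    (hd : p.natDegree ∣ Module.finrank F K) :
    (Finset.univ.filter fun a : K => minpoly F a = p).card = p.natDegree := by
  classical
  have : Finite F := Finite.of_injective _ (algebraMap F K).injective
  have : Fact (Irreducible p) := ⟨hi⟩
  have : FiniteDimensional F (AdjoinRoot p) := (AdjoinRoot.powerBasis hi.ne_zero).finite
  have hfr : Module.finrank F (AdjoinRoot p) = p.natDegree := by
    rw [(AdjoinRoot.powerBasis hi.ne_zero).finrank, AdjoinRoot.powerBasis_dim]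
  obtain ⟨σ⟩ := FiniteField.nonempty_algHom_of_finrank_dvd (F := F) (K := AdjoinRoot p) (L := K)
    (hfr ▸ hd)
  have hroot : aeval (σ (AdjoinRoot.root p)) p = 0 := by
    rw [aeval_algHom_apply, AdjoinRoot.aeval_eq, AdjoinRoot.mk_self, map_zero]
  have hsplit : (p.map (algebraMap F K)).Splits := by
    rw [minpoly.eq_of_irreducible_of_monic hi hroot hm]
    exact Normal.splits inferInstance _
  have hcard := card_rootSet_eq_natDegree (PerfectField.separable_of_irreducible hi) hsplit
  rw [← hcard, ← Set.toFinset_card]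
  congr 1
  ext a
  simp only [Finset.mem_filter, Finset.mem_univ, true_and, Set.mem_toFinset,
    mem_rootSet_of_ne hi.ne_zero]
  constructor
  · rintro rfl
    exact minpoly.aeval F a
  · intro h
    exact (minpoly.eq_of_irreducible_of_monic hi h hm).symm

theorem sum_minpoly {F K : Type*} [Field F] [Finite F] [Field K] [Algebra F K] [Fintype K]
    [FiniteDimensional F K] {R : Type*} [CommRing R] (g : F[X] → R) :
    ∑ a : K, g (minpoly F a) = ∑ d ∈ (Module.finrank F K).divisors,
      (d : R) * ∑ p ∈ (monicIrreducibles_finite F d).toFinset, g p := by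
  classical
  have hmaps : ∀ a ∈ (Finset.univ : Finset K), minpoly F a ∈
      (Module.finrank F K).divisors.biUnion
        fun d => (monicIrreducibles_finite F d).toFinset := by
    intro a _
    have hai : IsIntegral F a := Algebra.IsIntegral.isIntegral a
    simp only [Finset.mem_biUnion, Set.Finite.mem_toFinset, Nat.mem_divisors]
    exact ⟨_, ⟨minpoly.degree_dvd hai, Module.finrank_pos.ne'⟩,
      minpoly.monic hai, minpoly.irreducible hai, rfl⟩
  rw [← Finset.sum_fiberwise_of_maps_to hmaps, Finset.sum_biUnion]
  · refine Finset.sum_congr rfl fun d hd => ?_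
    rw [Finset.mul_sum]
    refine Finset.sum_congr rfl fun p hp => ?_
    obtain ⟨hm, hi, hdeg⟩ := (Set.Finite.mem_toFinset _).mp hp
    rw [Finset.sum_congr rfl fun a ha => by rw [(Finset.mem_filter.mp ha).2], Finset.sum_const,
      card_filter_minpoly_eq hm hi (hdeg ▸ Nat.dvd_of_mem_divisors hd), hdeg, nsmul_eq_mul]
  · intro d _ e _ hde
    refine Finset.disjoint_left.mpr fun p hp hp' => hde ?_
    exact ((Set.Finite.mem_toFinset _).mp hp).2.2.symm.trans
      ((Set.Finite.mem_toFinset _).mp hp').2.2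

theorem sum_quadraticChar_pow {F : Type*} [Field F] [Fintype F] [DecidableEq F] (u v : F)
    (d : ℕ) {k : ℕ} (hk : k ≠ 0) :
    ∑ p ∈ (monicIrreducibles_finite F d).toFinset, quadraticChar F (p.eval u * p.eval v) ^ k =
      ((squareSet u v d).ncard : ℤ) + (-1) ^ k * ((nonsquareSet u v d).ncard : ℤ) := by
  classical
  have hcard : ∀ c : ℤ, ({f | f ∈ monicIrreducibles F d ∧
      quadraticChar F (f.eval u * f.eval v) = c}.ncard : ℤ) =
      ∑ p ∈ (monicIrreducibles_finite F d).toFinset,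
        if quadraticChar F (p.eval u * p.eval v) = c then 1 else 0 := by
    intro c
    rw [Finset.sum_boole, ← Set.ncard_coe_finset]
    congr 2
    ext p
    simp
  rw [squareSet, nonsquareSet, hcard, hcard, Finset.mul_sum, ← Finset.sum_add_distrib]
  refine Finset.sum_congr rfl fun p _ => ?_
  -- The value 0 does occur, for `X - u` and `X - v`; `k ≠ 0` keeps `0 ^ k` from counting as 1.
  rcases quadraticChar_isQuadratic F (p.eval u * p.eval v) with h | h | h <;> simp [h, hk]

theorem sum_divisors_square_nonsquare {F : Type*} [Field F] [Fintype F] [DecidableEq F]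
    (hF : Odd (Fintype.card F)) {u v : F} (huv : u ≠ v) {n : ℕ} (hn : n ≠ 0) :
    ∑ d ∈ n.divisors, (d : ℤ) * (((squareSet u v d).ncard : ℤ) +
      (-1) ^ (n / d) * ((nonsquareSet u v d).ncard : ℤ)) = -1 := by
  have hchar : ringChar F ≠ 2 := fun h => by
    have := FiniteField.even_card_of_char_two h
    exact Nat.not_even_iff_odd.mpr hF (Nat.even_iff.mpr this)
  obtain ⟨p, hp⟩ := CharP.exists F
  have : Fact p.Prime := ⟨CharP.char_is_prime F p⟩
  have : NeZero n := ⟨hn⟩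
  let K := FiniteField.Extension F p n
  have : Fintype K := Fintype.ofFinite K
  have hfr : Module.finrank F K = n := FiniteField.finrank_extension F p n
  have h1 := ((quadraticChar_isQuadratic F).compNorm K).sum_mul_sub
    (MulChar.compNorm_ne_one K (quadraticChar_ne_one hchar))
    ((algebraMap F K).injective.ne huv)
  simp only [MulChar.compNorm_apply, Algebra.norm_sub_mul_sub, map_pow, hfr] at h1
  rw [sum_minpoly fun f : F[X] =>
    quadraticChar F (f.eval u * f.eval v) ^ (n / f.natDegree), hfr] at h1
  refine Eq.trans (Finset.sum_congr rfl fun d hd => ?_) h1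
  have hnd : n / d ≠ 0 := (Nat.div_pos (Nat.divisor_le hd) (Nat.pos_of_mem_divisors hd)).ne'
  rw [← sum_quadraticChar_pow u v d hnd]
  congr 1
  refine Finset.sum_congr rfl fun f hf => ?_
  rw [((Set.Finite.mem_toFinset _).mp hf).2.2]

/-- Only `d` with `n / d` even survive on the left, and `d ↦ 2 * d` carries them onto the even
divisors of `n`; the factor 2 is absorbed in the new weight. -/
theorem sum_divisors_even_quotient (c : ℕ → ℤ) {n : ℕ} (hn : n ≠ 0) :
    ∑ d ∈ n.divisors, (d : ℤ) * ((1 + (-1) ^ (n / d)) * c d) =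
      ∑ d ∈ n.divisors, (d : ℤ) * (if 2 ∣ d then c (d / 2) else 0) := by
  have hl : ∀ d : ℕ, (d : ℤ) * ((1 + (-1) ^ (n / d)) * c d) =
      if 2 ∣ n / d then 2 * d * c d else 0 := by
    intro d
    split_ifs with h
    · rw [(even_iff_two_dvd.mpr h).neg_one_pow]; ring
    · rw [(Nat.not_even_iff_odd.mp (mt even_iff_two_dvd.mp h)).neg_one_pow]; ring
  simp only [hl, mul_ite, mul_zero]
  rw [← Finset.sum_filter, ← Finset.sum_filter]
  refine Finset.sum_bij' (fun d _ => 2 * d) (fun e _ => e / 2) ?_ ?_ ?_ ?_ ?_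
  · intro d hd
    simp only [Finset.mem_filter, Nat.mem_divisors] at hd ⊢
    obtain ⟨⟨hdn, -⟩, h2⟩ := hd
    exact ⟨⟨mul_comm 2 d ▸ (Nat.dvd_div_iff_mul_dvd hdn).mp h2, hn⟩, dvd_mul_right _ _⟩
  · intro e he
    simp only [Finset.mem_filter, Nat.mem_divisors] at he ⊢
    obtain ⟨⟨hen, -⟩, m, rfl⟩ := he
    rw [Nat.mul_div_cancel_left _ two_pos]
    have hm : m ∣ n := (dvd_mul_left m 2).trans hen
    exact ⟨⟨hm, hn⟩, (Nat.dvd_div_iff_mul_dvd hm).mpr (mul_comm 2 m ▸ hen)⟩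
  · intro d _
    omega
  · intro e he
    exact Nat.mul_div_cancel' (Finset.mem_filter.mp he).2
  · intro d _
    rw [Nat.mul_div_cancel_left _ two_pos]
    push_cast
    ring

theorem eq_zero_of_sum_divisors_eq_one {g : ℕ → ℤ}
    (hg : ∀ n ≠ 0, ∑ d ∈ n.divisors, g d = 1) {n : ℕ} (hn : 2 ≤ n) : g n = 0 := by
  induction n using Nat.strong_induction_on with
  | _ n ih =>
    have h1 : g 1 = 1 := by simpa using hg 1 one_ne_zero
    have hs := hg n (by omega)
    -- By induction, 1 is the only proper divisor that contributes, and `g 1` already exhausts the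
    -- total.
    rw [← Nat.cons_self_properDivisors (by omega), Finset.sum_cons,
      Finset.sum_eq_single 1] at hs
    · omega
    · intro d hd hd1
      have hlt := (Nat.mem_properDivisors.mp hd).2
      have hpos := Nat.pos_of_mem_properDivisors hd
      exact ih d hlt (by omega)
    · intro h
      exact absurd (Nat.one_mem_properDivisors_iff_one_lt.mpr (by omega)) h

theorem theorem2 {F : Type*} [Field F] [Fintype F] [DecidableEq F]
    (hF : Odd (Fintype.card F)) (u v : F) (huv : u ≠ v) (n : ℕ) (hn : 2 ≤ n) :
    ((nonsquareSet u v n).ncard : ℤ) - ((squareSet u v n).ncard : ℤ) =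
      if 2 ∣ n then ((nonsquareSet u v (n / 2)).ncard : ℤ) else 0 := by
  have key := eq_zero_of_sum_divisors_eq_one (g := fun d : ℕ =>
    (d : ℤ) * (((nonsquareSet u v d).ncard : ℤ) - ((squareSet u v d).ncard : ℤ) -
      if 2 ∣ d then ((nonsquareSet u v (d / 2)).ncard : ℤ) else 0)) ?_ hn
  · rcases mul_eq_zero.mp key with h | h
    · omega
    · exact sub_eq_zero.mp h
  · intro m hm
    have h1 := sum_divisors_square_nonsquare hF huv hm
    have h2 := sum_divisors_even_quotient (fun d => ((nonsquareSet u v d).ncard : ℤ)) hm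
    simp only [mul_sub, Finset.sum_sub_distrib]
    rw [← h2, ← Finset.sum_sub_distrib, ← Finset.sum_sub_distrib]
    refine Eq.trans ((Finset.sum_congr rfl fun d _ => ?_).trans (Finset.sum_neg_distrib _))
      (neg_eq_iff_eq_neg.mpr h1)
    ring
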